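/- Let $\mathcal C=[0,1]^3$ be the cube whose first coordinate runs from the left face to the right face, whose second coordinate runs from the front face to the back face, and whose third coordinate runs from the floor to the ceiling. Let $F:\mathcal C\to T^3=\mathbb R^3/\mathbb Z^3=S^1\times S^1\times S^1$ be the quotient map that glues opposite faces. Let $K\subset T^3$ be an oriented knot, i.e. the image of an embedding of the oriented circle $S^1=\mathbb R/\mathbb Z$, and put $L'=F^{-1}(K)\subset\mathcal C$. Assume that $K$ is in general position with respect to the cube: (a) $L'$ does not meet the edges and vertices of $\mathcal C$; (b) $L'\cap\partial\mathcal C$ is finite; (c) $K$ passes through the faces and does not merely touch them: at no point $P\in L'\cap\partial\mathcal C$ does a strand of $L'$ arrive from the interior of $\mathcal C$ at $P$ while another strand of $L'$ starts at the same point $P$ back into the interior. (This holds in particular if $K$ is smooth and $L'$ is nowhere tangent to $\partial\mathcal C$, as is required of a knot that is given by a diagram on the floor of the cube.) Thus every point of $L'\cap\partial\mathcal C$ is an endpoint of exactly one strand of $L'$. Let $X_1,\dots,X_n$, $Y_1,\dots,Y_m$ and $Z_1,\dots,Z_l$ be the points of $L'$ on the left face, on the front face and on the ceiling, respectively. With respect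 to the orientation of $K$, let - $\epsilon_i=1$ if the strand of $L'$ at $X_i$ starts from $X_i$, and $\epsilon_i=-1$ if it ends in $X_i$; - $\nu_j=1$ if the strand of $L'$ at $Y_j$ starts from $Y_j$, and $\nu_j=-1$ if it ends in $Y_j$; - $\tau_k=1$ if the strand of $L'$ at $Z_k$ starts from $Z_k$, and $\tau_k=-1$ if it ends in $Z_k$ (so that the knot goes on from the opposite point of the floor). Put $$\delta=\sum_{i=1}^n\epsilon_i,\qquad \sigma=\sum_{j=1}^m\nu_j,\qquad \xi=\sum_{k=1}^l(-\tau_k).$$ Then there is an isomorphism $H_1(T^3;\mathbb Z)\cong\mathbb Z^3$, independent of $K$, under which the classes of the three coordinate circles of $T^3$ (the images of the edges of $\mathcal C$ at the vertex $(0,0,0)$), oriented from left to right, from front to back and from the floor to the ceiling, correspond in this order to the standard basis of $\mathbb Z^3$, and under which, for every such $K$, the homology class of $K$ is $$[K]=(\delta,\sigma,\xi).$$ -/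

import Mathlib

open CategoryTheory Simplicial

noncomputable section

/-! ### The 3-torus as a cube with opposite faces glued -/

/-- The 3-torus `S¹ × S¹ × S¹`, with `S¹ = ℝ / ℤ`. -/
abbrev Torus3 : Type := Fin 3 → UnitAddCircle

/-- The cube `[0,1]³`. Coordinate `0` runs from the left face to the right face, coordinate `1` from
the front face to the back face, coordinate `2` from the floor to the ceiling. Its
boundary, the union of the six faces, is `Cube.boundary (Fin 3)`. -/
abbrev Cube3 : Type := Fin 3 → unitInterval

/-- The quotient map from the cube to the 3-torus, gluing opposite faces. -/
def cubeQuot (P : Cube3) : Torus3 := fun i => ((P i : ℝ) : UnitAddCircle)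

namespace Cube3

def leftFace : Set Cube3 := {P | P 0 = 0}

def frontFace : Set Cube3 := {P | P 1 = 0}

def ceiling : Set Cube3 := {P | P 2 = 1}

/-- The union of the (closed) edges of the cube. It contains the vertices. -/
def edges : Set Cube3 := {P | ∃ i j, i ≠ j ∧ (P i = 0 ∨ P i = 1) ∧ (P j = 0 ∨ P j = 1)}

end Cube3

/-! ### Oriented knots -/

/-- An oriented knot in the 3-torus: an embedding of the circle `ℝ / ℤ`, which carries its standard
orientation. -/
structure OrientedKnot where
  toMap : C(UnitAddCircle, Torus3)
  isEmbedding : Topology.IsEmbedding toMap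

namespace OrientedKnot

variable (K : OrientedKnot)

/-- The preimage `L'` of the knot in the cube. -/
def inCube : Set Cube3 := cubeQuot ⁻¹' Set.range K.toMap

/-- Along the orientation of `K`, a strand of `K.inCube` starts from the point `P` of the cube and
runs into the interior of the cube. -/
def StartsAt (P : Cube3) : Prop :=
  ∃ (t : UnitAddCircle) (ε : ℝ) (a : ℝ → Cube3), 0 < ε ∧ ContinuousOn a (Set.Icc 0 ε) ∧ a 0 = P ∧
    (∀ s ∈ Set.Icc 0 ε, cubeQuot (a s) = K.toMap (t + (s : UnitAddCircle))) ∧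
    ∀ s ∈ Set.Ioc 0 ε, a s ∉ Cube.boundary (Fin 3)

/-- Along the orientation of `K`, a strand of `K.inCube` comes from the interior of the cube and
ends in the point `P` of the cube. The strand `a` is parametrized backwards. -/
def EndsAt (P : Cube3) : Prop :=
  ∃ (t : UnitAddCircle) (ε : ℝ) (a : ℝ → Cube3), 0 < ε ∧ ContinuousOn a (Set.Icc 0 ε) ∧ a 0 = P ∧
    (∀ s ∈ Set.Icc 0 ε, cubeQuot (a s) = K.toMap (t - (s : UnitAddCircle))) ∧
    ∀ s ∈ Set.Ioc 0 ε, a s ∉ Cube.boundary (Fin 3)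

/-- The position of a knot with respect to the cube that is required of a diagram. -/
structure InGeneralPosition : Prop where
  /-- The knot avoids the vertices and the edges of the cube. -/
  avoids_edges : Disjoint K.inCube Cube3.edges
  /-- The knot meets the boundary of the cube in finitely many points. -/
  finite_boundary : (K.inCube ∩ Cube.boundary (Fin 3)).Finite
  /-- The knot does not touch a face from one side: it never arrives at a boundary point `P` of the
  cube and returns from `P` into the cube. (A knot with a tangent line transverse to the face at
  every boundary point has this property, and so has a polygonal knot that passes through the
  faces.) -/
  not_touching : ∀ P ∈ K.inCube ∩ Cube.boundary (Fin 3), ¬ (K.StartsAt P ∧ K.EndsAt P)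

open Classical in
/-- The sign of a boundary point `P`: `1` if the strand of the knot at `P` starts from `P`, and `-1`
if it ends in `P`. -/
def sign (P : Cube3) : ℤ := if K.StartsAt P then 1 else if K.EndsAt P then -1 else 0

/-- `δ`, the sum of the signs `ε_i` of the points `X_i` of the knot on the left face. -/
def delta : ℤ := ∑ᶠ P ∈ K.inCube ∩ Cube3.leftFace, K.sign P

/-- `σ`, the sum of the signs `ν_j` of the points `Y_j` of the knot on the front face. -/
def sigma : ℤ := ∑ᶠ P ∈ K.inCube ∩ Cube3.frontFace, K.sign P

/-- `ξ`, the sum of `-τ_k` over the points `Z_k` of the knot on the ceiling, where `τ_k` is the sign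
of `Z_k`: it is `1` if the strand starts from the ceiling (the positive pole of the vertex), and `-1`
if it ends there, so that the knot goes on from the floor (the negative pole). -/
def xi : ℤ := ∑ᶠ P ∈ K.inCube ∩ Cube3.ceiling, - K.sign P

end OrientedKnot

/-! ### First singular homology and the classes of loops -/

/-- The first singular homology functor with integer coefficients. -/
def H1Functor : TopCat.{0} ⥤ ModuleCat.{0} ℤ :=
  (AlgebraicTopology.singularHomologyFunctor (ModuleCat.{0} ℤ) 1).obj (ModuleCat.of ℤ ℤ)

/-- The first singular homology group `H₁(X; ℤ)`. -/
abbrev H1 (X : Type) [TopologicalSpace X] : ModuleCat.{0} ℤ := H1Functor.obj (TopCat.of X)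

/-- The singular 1-simplex running once around the circle `ℝ / ℤ` in the positive direction: the
point with barycentric coordinates `(1 - s, s)` goes to `s`. -/
def circleSimplex : (TopCat.toSSet.obj (TopCat.of UnitAddCircle)) _⦋1⦌ :=
  (TopCat.toSSetObjEquiv (TopCat.of UnitAddCircle) (Opposite.op ⦋1⦌)).symm
    { toFun := fun p => ((p.1 1 : ℝ) : UnitAddCircle)
      continuous_toFun := (AddCircle.continuous_mk' 1).comp
        ((continuous_apply 1).comp continuous_subtype_val) }

/-- Both faces of `circleSimplex` are the base point of the circle, so it is a cycle. -/
theorem circleSimplex_faces :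
    (TopCat.toSSet.obj (TopCat.of UnitAddCircle)).δ 0 circleSimplex =
      (TopCat.toSSet.obj (TopCat.of UnitAddCircle)).δ 1 circleSimplex := by
  apply (TopCat.toSSetObjEquiv (TopCat.of UnitAddCircle) (Opposite.op ⦋0⦌)).injective
  ext p
  have h0 := TopCat.toSSetObjEquiv_δ_apply circleSimplex 0 p
  have h1 := TopCat.toSSetObjEquiv_δ_apply circleSimplex 1 p
  refine h0.trans (Eq.trans ?_ h1.symm)
  have e0 : (stdSimplex.map (Fin.succAbove (0 : Fin 2)) p).1 1 = 1 := by
    simp [stdSimplex.map, FunOnFinite.linearMap_apply_apply]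
    rfl
  have e1 : (stdSimplex.map (Fin.succAbove (1 : Fin 2)) p).1 1 = 0 := by
    simp [stdSimplex.map, FunOnFinite.linearMap_apply_apply]
  change (((stdSimplex.map (Fin.succAbove (0 : Fin 2)) p).1 1 : ℝ) : UnitAddCircle) =
    (((stdSimplex.map (Fin.succAbove (1 : Fin 2)) p).1 1 : ℝ) : UnitAddCircle)
  rw [e0, e1]
  simp

theorem circleSimplex_d :
    (TopCat.toSSet.obj (TopCat.of UnitAddCircle)).ιChainComplex
        (R := ModuleCat.of.{0} ℤ ℤ) circleSimplex ≫
      ((TopCat.toSSet.obj (TopCat.of UnitAddCircle)).chainComplex (ModuleCat.of ℤ ℤ)).d 1 0 = 0 := by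
  rw [SSet.ιChainComplex_d, Fin.sum_univ_two, circleSimplex_faces]
  simp

/-- The fundamental class of the positively oriented circle in `H₁(ℝ / ℤ)`: the homology class of
the cycle `circleSimplex`. -/
def circleClass : H1 UnitAddCircle :=
  (HomologicalComplex.liftCycles
      ((TopCat.toSSet.obj (TopCat.of UnitAddCircle)).chainComplex (ModuleCat.of.{0} ℤ ℤ))
      ((TopCat.toSSet.obj (TopCat.of UnitAddCircle)).ιChainComplex circleSimplex) 0 (by simp)
      circleSimplex_d ≫
    HomologicalComplex.homologyπ _ 1).hom (1 : ℤ)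

/-- The homology class of a loop `f : ℝ / ℤ → X`, the image of the fundamental class of the
circle. -/
def loopClass {X : Type} [TopologicalSpace X] (f : C(UnitAddCircle, X)) : H1 X :=
  (H1Functor.map (TopCat.ofHom f)).hom circleClass

/-- The homology class `[K]` of an oriented knot in `H₁(T³)`. -/
def OrientedKnot.homologyClass (K : OrientedKnot) : H1 Torus3 := loopClass K.toMap

/-- The coordinate circles of the 3-torus, the images of the edges of the cube at the vertex
`(0, 0, 0)`: for `i = 0, 1, 2` oriented from left to right, from front to back, from floor to
ceiling. -/
def coordCircle (i : Fin 3) : C(UnitAddCircle, Torus3) where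
  toFun s := Pi.single i s
  continuous_toFun := continuous_single (A := fun _ : Fin 3 => UnitAddCircle) i

end

noncomputable section

/-! ### Lifts to the universal cover of a torus -/

/-! Lift the knot to a path `g` in ℝ³. The isomorphism sends the class of a loop to the difference
of the floors of the two ends of its lift. Each coordinate of this difference is the signed number
of integer values crossed by that coordinate of `g`, hence the signed number of passages through a
pair of opposite faces.

The isomorphism is built on singular chains. The change of floors along a lifted 1-simplex
(`advance`) telescopes around a triangle, so it is a cocycle. For injectivity, coning a lifted
simplex from the origin (`opchain_proj`) shows that modulo boundaries it equals S(b) - S(a), where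
a, b are its ends and S(v) is the class of the projected segment from 0 to v. Since S(n + v) = S(n)
+ S(v) for lattice vectors n (`segmentClass_int_add`), integer and fractional parts separate: every
chain modulo boundaries is a term depending on its advance plus a term depending on its boundary
(`opcycles_decomposition`), and the latter vanishes on homology. The coordinate circles give
surjectivity.

For the count, `hasStrand_facePoint_iff` reads strands in the cube off the increments of `g`. In
each time direction exactly one of the two cube points over a crossing carries a strand. The
no-touching condition puts the forward and the backward strand on opposite faces, so `g` really
crosses, up or down (`crosses`). `rightFloor_sub_eq_sum` adds up the crossings, and
`bijOn_facePoint` matches crossing times with points on a face. -/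

/-- A map from a contractible space lifts through a surjective covering map. -/
theorem IsCoveringMap.exists_lift_of_contractible {A E X : Type*} [TopologicalSpace A]
    [TopologicalSpace E] [TopologicalSpace X] [ContractibleSpace A] {p : E → X}
    (cov : IsCoveringMap p) (surj : Function.Surjective p) (f : C(A, X)) :
    ∃ g : C(A, E), ∀ a, p (g a) = f a := by
  obtain ⟨x, ⟨H⟩⟩ := (contractible_iff_id_nullhomotopic A).1 inferInstance
  obtain ⟨e, he⟩ := surj (f x)
  -- The contraction is run backwards: the homotopy starts at a constant map, which lifts to a
  -- constant, and ends at `f`.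
  let F : C(unitInterval × A, X) := f.comp H.symm.toContinuousMap
  have h0 : ∀ a, F (0, a) = p (ContinuousMap.const A e a) := fun a => by simp [F, he]
  refine ⟨(cov.liftHomotopy F _ h0).comp ⟨fun a => (1, a), by fun_prop⟩, fun a => ?_⟩
  have := congrFun (cov.liftHomotopy_lifts F _ h0) (1, a)
  simpa [F] using this

instance stdSimplex.contractibleSpace {ι : Type*} [Fintype ι] [Nonempty ι] :
    ContractibleSpace (stdSimplex ℝ ι) :=
  (convex_stdSimplex ℝ ι).contractibleSpace
    (Set.nonempty_coe_sort.1 (inferInstance : Nonempty (stdSimplex ℝ ι)))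

namespace UnitTorus

variable {ι : Type}

/-- The universal covering of the torus. -/
def proj : C(ι → ℝ, ι → UnitAddCircle) where
  toFun v i := (v i : UnitAddCircle)
  continuous_toFun := continuous_pi fun i =>
    (AddCircle.continuous_mk' 1).comp (continuous_apply i)

@[simp]
theorem proj_apply (v : ι → ℝ) (i : ι) : proj v i = (v i : UnitAddCircle) := rfl

theorem exists_lift {A : Type*} [TopologicalSpace A] [ContractibleSpace A]
    (f : C(A, ι → UnitAddCircle)) : ∃ g : C(A, ι → ℝ), ∀ a, proj (g a) = f a := by
  choose g hg using fun i => (AddCircle.isCoveringMap_coe (1 : ℝ)).exists_lift_of_contractible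
    QuotientAddGroup.mk_surjective (⟨fun a => f a i, by fun_prop⟩ : C(A, UnitAddCircle))
  exact ⟨⟨fun a i => g i a, by fun_prop⟩, fun a => funext fun i => hg i a⟩

end UnitTorus

theorem UnitAddCircle.coe_eq_coe_iff {a b : ℝ} :
    (a : UnitAddCircle) = b ↔ ∃ n : ℤ, b = a + n := by
  rw [eq_comm, ← sub_eq_zero, ← AddCircle.coe_sub, AddCircle.coe_eq_zero_iff]
  refine exists_congr fun n => ?_
  simp only [zsmul_eq_mul, mul_one]
  constructor <;> intro h <;> linarith

/-- Two lifts of the same map to the circle differ by an integer. -/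
theorem UnitAddCircle.exists_eq_add_int_of_coe_eq {A : Type*} [TopologicalSpace A]
    [PreconnectedSpace A] {g h : A → ℝ} (hg : Continuous g) (hh : Continuous h)
    (e : ∀ a, (g a : UnitAddCircle) = h a) : ∃ n : ℤ, ∀ a, h a = g a + n := by
  by_cases hA : Nonempty A
  · obtain ⟨y⟩ := hA
    obtain ⟨n, hn⟩ := UnitAddCircle.coe_eq_coe_iff.1 (e y)
    refine ⟨n, fun a => congrFun ((AddCircle.isCoveringMap_coe (1 : ℝ)).eq_of_comp_eq hh
      (by fun_prop : Continuous fun a => g a + n) ?_ y hn) a⟩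
    funext a
    exact ((UnitAddCircle.coe_eq_coe_iff.2 ⟨n, rfl⟩).symm.trans (e a)).symm
  · exact ⟨0, fun a => (hA ⟨a⟩).elim⟩

namespace UnitTorus

variable {ι : Type}

/-- Two lifts differ by a constant integer in each coordinate, which cancels in the difference of
floors. This makes `advance` independent of the chosen lift. -/
theorem floor_sub_floor_eq {A : Type*} [TopologicalSpace A]
    [PreconnectedSpace A] {g h : C(A, ι → ℝ)} (e : ∀ a, proj (g a) = proj (h a)) (x y : A)
    (i : ι) : ⌊g x i⌋ - ⌊g y i⌋ = ⌊h x i⌋ - ⌊h y i⌋ := by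
  obtain ⟨n, hn⟩ := UnitAddCircle.exists_eq_add_int_of_coe_eq
    (g := fun a => g a i) (h := fun a => h a i) (by fun_prop) (by fun_prop)
    (fun a => congrFun (e a) i)
  rw [hn, hn, Int.floor_add_intCast, Int.floor_add_intCast]
  ring

end UnitTorus

/-! ### The first homology of a torus -/

/-- The continuous map between standard simplices induced by a map of vertices. -/
def stdSimplex.mapC {m n : ℕ} (f : Fin m → Fin n) :
    C(stdSimplex ℝ (Fin m), stdSimplex ℝ (Fin n)) :=
  ⟨stdSimplex.map f, stdSimplex.continuous_map f⟩

/-! ### Singular chains in low degrees and chains modulo boundaries -/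

namespace SingularOne

variable (X : Type) [TopologicalSpace X]

/-- The integral singular chain complex. -/
abbrev chains : ChainComplex (ModuleCat.{0} ℤ) ℕ :=
  (TopCat.toSSet.obj (TopCat.of X)).chainComplex (ModuleCat.of ℤ ℤ)

variable {X}

/-- The singular simplex given by a continuous map. -/
def simplex {n : ℕ} (σ : C(stdSimplex ℝ (Fin (n + 1)), X)) :
    (TopCat.toSSet.obj (TopCat.of X)) _⦋n⦌ :=
  (TopCat.toSSetObjEquiv (TopCat.of X) (Opposite.op ⦋n⦌)).symm σ

theorem simplex_surjective {n : ℕ} (x : (TopCat.toSSet.obj (TopCat.of X)) _⦋n⦌) :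
    ∃ σ : C(stdSimplex ℝ (Fin (n + 1)), X), simplex σ = x :=
  (TopCat.toSSetObjEquiv (TopCat.of X) (Opposite.op ⦋n⦌)).symm.surjective x

theorem δ_simplex {n : ℕ} (σ : C(stdSimplex ℝ (Fin (n + 2)), X)) (i : Fin (n + 2)) :
    (TopCat.toSSet.obj (TopCat.of X)).δ i (simplex σ) =
      simplex (σ.comp (stdSimplex.mapC i.succAbove)) := by
  apply (TopCat.toSSetObjEquiv (TopCat.of X) (Opposite.op ⦋n⦌)).injective
  ext p
  refine (TopCat.toSSetObjEquiv_δ_apply (simplex σ) i p).trans ?_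
  simp only [simplex, Equiv.apply_symm_apply]
  rfl

/-- The generator of the singular chains given by a singular simplex. -/
def chain {n : ℕ} (σ : C(stdSimplex ℝ (Fin (n + 1)), X)) : (chains X).X n :=
  ((TopCat.toSSet.obj (TopCat.of X)).ιChainComplex (R := ModuleCat.of ℤ ℤ) (simplex σ)).hom
    (1 : ℤ)

theorem d_chain {n : ℕ} (σ : C(stdSimplex ℝ (Fin (n + 2)), X)) :
    ((chains X).d (n + 1) n).hom (chain σ) =
      ∑ i : Fin (n + 2), (-1 : ℤ) ^ i.val • chain (σ.comp (stdSimplex.mapC i.succAbove)) := by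
  have := congrArg (fun f => f.hom (1 : ℤ)) ((TopCat.toSSet.obj (TopCat.of X)).ιChainComplex_d
    (R := ModuleCat.of ℤ ℤ) (simplex σ))
  refine this.trans ?_
  simp only [δ_simplex, ModuleCat.hom_sum, LinearMap.sum_apply]
  rfl

theorem hom_ext {n : ℕ} {M : ModuleCat.{0} ℤ} {f g : (chains X).X n ⟶ M}
    (h : ∀ σ : C(stdSimplex ℝ (Fin (n + 1)), X), f.hom (chain σ) = g.hom (chain σ)) : f = g := by
  apply SSet.chainComplex_hom_ext
  intro x
  obtain ⟨σ, rfl⟩ := simplex_surjective x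
  ext
  exact h σ

/-- The homomorphism on singular chains with given values on the simplices. -/
def desc {n : ℕ} {M : ModuleCat.{0} ℤ} (φ : C(stdSimplex ℝ (Fin (n + 1)), X) → M) :
    (chains X).X n ⟶ M :=
  Limits.Cofan.IsColimit.desc
    ((TopCat.toSSet.obj (TopCat.of X)).isColimitChainComplexXCofan (ModuleCat.of ℤ ℤ) n)
    fun x => ModuleCat.ofHom (LinearMap.toSpanSingleton ℤ M
      (φ (TopCat.toSSetObjEquiv (TopCat.of X) (Opposite.op ⦋n⦌) x)))

@[simp]
theorem desc_chain {n : ℕ} {M : ModuleCat.{0} ℤ} (φ : C(stdSimplex ℝ (Fin (n + 1)), X) → M)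
    (σ : C(stdSimplex ℝ (Fin (n + 1)), X)) : (desc φ).hom (chain σ) = φ σ := by
  have := congrArg (fun f => f.hom (1 : ℤ)) (Limits.Cofan.IsColimit.fac
    ((TopCat.toSSet.obj (TopCat.of X)).isColimitChainComplexXCofan (ModuleCat.of ℤ ℤ) n)
    (fun x => ModuleCat.ofHom (LinearMap.toSpanSingleton ℤ M
      (φ (TopCat.toSSetObjEquiv (TopCat.of X) (Opposite.op ⦋n⦌) x)))) (simplex σ))
  refine this.trans ?_
  simp only [simplex, ModuleCat.hom_ofHom, Equiv.apply_symm_apply]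
  exact @one_smul ℤ M _ M.isModule.toMulAction _

/-- The class of a singular simplex in the chains modulo boundaries. -/
def opchain {n : ℕ} (σ : C(stdSimplex ℝ (Fin (n + 1)), X)) : (chains X).opcycles n :=
  ((chains X).pOpcycles n).hom (chain σ)

theorem d_chain_one (σ : C(stdSimplex ℝ (Fin 2), X)) :
    ((chains X).d 1 0).hom (chain σ) =
      chain (n := 0) (σ.comp (stdSimplex.mapC (Fin.succAbove 0))) -
        chain (n := 0) (σ.comp (stdSimplex.mapC (Fin.succAbove 1))) := by
  rw [d_chain (n := 0) σ, Fin.sum_univ_two, sub_eq_add_neg]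
  congr 1
  · exact one_zsmul _
  · exact neg_one_zsmul _

theorem d_chain_two (σ : C(stdSimplex ℝ (Fin 3), X)) :
    ((chains X).d 2 1).hom (chain σ) =
      chain (n := 1) (σ.comp (stdSimplex.mapC (Fin.succAbove 0))) -
        chain (n := 1) (σ.comp (stdSimplex.mapC (Fin.succAbove 1))) +
        chain (n := 1) (σ.comp (stdSimplex.mapC (Fin.succAbove 2))) := by
  rw [d_chain (n := 1) σ, Fin.sum_univ_three, sub_eq_add_neg]
  congr 2
  · exact one_zsmul _
  · exact neg_one_zsmul _
  · exact (congrArg (· • _) (by norm_num : (-1 : ℤ) ^ 2 = 1)).trans (one_zsmul _)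

theorem opchain_relation (σ : C(stdSimplex ℝ (Fin 3), X)) :
    opchain (n := 1) (σ.comp (stdSimplex.mapC (Fin.succAbove 0))) -
      opchain (n := 1) (σ.comp (stdSimplex.mapC (Fin.succAbove 1))) +
      opchain (n := 1) (σ.comp (stdSimplex.mapC (Fin.succAbove 2))) = 0 := by
  have := congrArg (fun f => f.hom (chain σ)) ((chains X).d_pOpcycles 2 1)
  simp only [ModuleCat.hom_comp, LinearMap.comp_apply, d_chain_two, map_add, map_sub] at this
  exact this

/-- The class of a loop, in the chains modulo boundaries. -/
theorem homologyι_loopClass (f : C(UnitAddCircle, X)) :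
    ((chains X).homologyι 1).hom (loopClass f) =
      opchain (n := 1) (f.comp ⟨fun p => ((p.1 1 : ℝ) : UnitAddCircle),
        (AddCircle.continuous_mk' 1).comp
        ((continuous_apply 1).comp continuous_subtype_val)⟩) := by
  have h1 := congrArg (fun g => g.hom circleClass) (HomologicalComplex.homologyι_naturality
    (SSet.chainComplexMap (TopCat.toSSet.map (TopCat.ofHom f)) (ModuleCat.of.{0} ℤ ℤ)) 1)
  have h2 : ((chains UnitAddCircle).homologyι 1).hom circleClass =
      ((chains UnitAddCircle).pOpcycles 1).hom
        (((TopCat.toSSet.obj (TopCat.of UnitAddCircle)).ιChainComplex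
          (R := ModuleCat.of ℤ ℤ) circleSimplex).hom (1 : ℤ)) := by
    have := (chains UnitAddCircle).homology_π_ι 1
    have h3 := congrArg (fun g => g.hom (1 : ℤ))
      (congrArg (fun g => HomologicalComplex.liftCycles
      ((TopCat.toSSet.obj (TopCat.of UnitAddCircle)).chainComplex (ModuleCat.of.{0} ℤ ℤ))
      ((TopCat.toSSet.obj (TopCat.of UnitAddCircle)).ιChainComplex circleSimplex) 0 (by simp)
      circleSimplex_d ≫ g) this)
    rw [HomologicalComplex.liftCycles_i_assoc] at h3
    exact h3
  refine h1.trans ?_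
  refine (congrArg (HomologicalComplex.opcyclesMap (SSet.chainComplexMap
    (TopCat.toSSet.map (TopCat.ofHom f)) (ModuleCat.of.{0} ℤ ℤ)) 1).hom h2).trans ?_
  have h4 := congrArg (fun g => ((TopCat.toSSet.obj (TopCat.of UnitAddCircle)).ιChainComplex
    (R := ModuleCat.of ℤ ℤ) circleSimplex ≫ g).hom (1 : ℤ)) (HomologicalComplex.p_opcyclesMap
    (SSet.chainComplexMap (TopCat.toSSet.map (TopCat.ofHom f)) (ModuleCat.of.{0} ℤ ℤ)) 1)
  refine h4.trans ?_
  rw [SSet.ι_chainComplexMap_f_assoc]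
  rfl

end SingularOne

open SingularOne

/-! ### Cones and segments in the universal cover -/

/-- The cone over a bounded continuous function on the line is continuous. -/
theorem continuous_mul_comp_div {γ : ℝ → ℝ} (hγ : Continuous γ) {C : ℝ} (hC : ∀ s, |γ s| ≤ C) :
    Continuous fun p : ℝ × ℝ => p.1 * γ (p.2 / p.1) := by
  rw [continuous_iff_continuousAt]
  rintro ⟨r, u⟩
  -- Over `r = 0` the quotient is meaningless, but boundedness of `γ` squeezes the product to 0.
  by_cases hr : r = 0
  · subst hr
    have h : Filter.Tendsto (fun p : ℝ × ℝ => |p.1| * C) (nhds (0, u)) (nhds 0) := by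
      have : Continuous fun p : ℝ × ℝ => |p.1| * C := by fun_prop
      simpa using this.tendsto (0, u)
    unfold ContinuousAt
    simp only [zero_mul]
    refine squeeze_zero_norm (fun p => ?_) h
    rw [Real.norm_eq_abs, abs_mul]
    exact mul_le_mul_of_nonneg_left (hC _) (abs_nonneg _)
  · have : ContinuousAt (fun p : ℝ × ℝ => p.2 / p.1) (r, u) :=
      continuousAt_snd.div continuousAt_fst hr
    exact continuousAt_fst.mul (hγ.continuousAt.comp this)

namespace UnitTorus

variable {ι : Type}

/-- The point `(1 - s, s)` of the standard simplex, where `s` is cut off to the unit interval. -/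
def edgePoint (s : ℝ) : stdSimplex ℝ (Fin 2) :=
  (stdSimplexEquivIcc ℝ).symm (Set.projIcc 0 1 zero_le_one s)

theorem continuous_edgePoint : Continuous edgePoint := by
  refine Continuous.subtype_mk (continuous_pi (Fin.forall_fin_two.2 ⟨?_, ?_⟩)) _
  · exact continuous_const.sub (continuous_subtype_val.comp continuous_projIcc)
  · exact continuous_subtype_val.comp continuous_projIcc

theorem edgePoint_apply_one (p : stdSimplex ℝ (Fin 2)) : edgePoint (p 1) = p := by
  rw [edgePoint, Set.projIcc_of_mem zero_le_one ⟨stdSimplex.zero_le p 1, stdSimplex.le_one p 1⟩]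
  exact (stdSimplexEquivIcc ℝ).symm_apply_apply p

theorem edgePoint_zero : edgePoint 0 = stdSimplex.vertex 0 := by
  simpa using edgePoint_apply_one (stdSimplex.vertex 0)

theorem edgePoint_one : edgePoint 1 = stdSimplex.vertex 1 := by
  simpa using edgePoint_apply_one (stdSimplex.vertex 1)

theorem continuous_coord {n : ℕ} (k : Fin n) :
    Continuous fun p : stdSimplex ℝ (Fin n) => p.1 k :=
  (continuous_apply k).comp continuous_subtype_val

/-- The singular simplex running along the segment from `a` to `a + v`. -/
def segment (a v : ι → ℝ) : C(stdSimplex ℝ (Fin 2), ι → ℝ) where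
  toFun p i := a i + p.1 1 * v i
  continuous_toFun := continuous_pi fun _ =>
    continuous_const.add ((continuous_coord 1).mul continuous_const)

/-- The cone with apex `0` over a singular 1-simplex. -/
def cone (g : C(stdSimplex ℝ (Fin 2), ι → ℝ)) : C(stdSimplex ℝ (Fin 3), ι → ℝ) where
  -- Vertex 0 is the apex. The point of `g` is found by radial projection from it; at the apex the
  -- quotient is 0/0, but the factor in front vanishes.
  toFun p i := (p.1 1 + p.1 2) * g (edgePoint (p.1 2 / (p.1 1 + p.1 2))) i
  continuous_toFun := by
    refine continuous_pi fun i => ?_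
    have hc : Continuous fun q => g q i := by fun_prop
    obtain ⟨C, hC⟩ := isCompact_univ.exists_bound_of_continuousOn hc.continuousOn
    exact (continuous_mul_comp_div (γ := fun s => g (edgePoint s) i)
      (hc.comp continuous_edgePoint) fun s => hC _ (Set.mem_univ _)).comp
      (((continuous_coord (1 : Fin 3)).add (continuous_coord 2)).prodMk (continuous_coord 2))

theorem mapC_succAbove_apply_self {n : ℕ} (j : Fin (n + 2)) (p : stdSimplex ℝ (Fin (n + 1))) :
    stdSimplex.mapC j.succAbove p j = 0 := by
  simp [stdSimplex.mapC, FunOnFinite.linearMap_apply_apply, Fin.succAbove_ne]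

theorem mapC_succAbove_apply_succAbove {n : ℕ} (j : Fin (n + 2)) (p : stdSimplex ℝ (Fin (n + 1)))
    (k : Fin (n + 1)) : stdSimplex.mapC j.succAbove p (j.succAbove k) = p k := by
  simp [stdSimplex.mapC, FunOnFinite.linearMap_apply_apply, Finset.filter_eq']

theorem cone_face_zero (g : C(stdSimplex ℝ (Fin 2), ι → ℝ)) :
    (cone g).comp (stdSimplex.mapC (Fin.succAbove 0)) = g := by
  ext p i
  have h1 : (stdSimplex.mapC (Fin.succAbove 0) p) 1 = p 0 :=
    mapC_succAbove_apply_succAbove (0 : Fin 3) p 0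
  have h2 : (stdSimplex.mapC (Fin.succAbove 0) p) 2 = p 1 :=
    mapC_succAbove_apply_succAbove (0 : Fin 3) p 1
  change (stdSimplex.mapC (Fin.succAbove 0) p 1 + stdSimplex.mapC (Fin.succAbove 0) p 2) *
    g (edgePoint (stdSimplex.mapC (Fin.succAbove 0) p 2 /
      (stdSimplex.mapC (Fin.succAbove 0) p 1 + stdSimplex.mapC (Fin.succAbove 0) p 2))) i = _
  rw [h1, h2, stdSimplex.add_eq_one, one_mul, div_one, edgePoint_apply_one]

theorem cone_face_one (g : C(stdSimplex ℝ (Fin 2), ι → ℝ)) :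
    (cone g).comp (stdSimplex.mapC (Fin.succAbove 1)) =
      segment 0 (g (stdSimplex.vertex 1)) := by
  ext p i
  have h1 : (stdSimplex.mapC (Fin.succAbove 1) p) 1 = 0 :=
    mapC_succAbove_apply_self (1 : Fin 3) p
  have h2 : (stdSimplex.mapC (Fin.succAbove 1) p) 2 = p 1 :=
    mapC_succAbove_apply_succAbove (1 : Fin 3) p 1
  change (stdSimplex.mapC (Fin.succAbove 1) p 1 + stdSimplex.mapC (Fin.succAbove 1) p 2) *
    g (edgePoint (stdSimplex.mapC (Fin.succAbove 1) p 2 /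
      (stdSimplex.mapC (Fin.succAbove 1) p 1 + stdSimplex.mapC (Fin.succAbove 1) p 2))) i =
    0 + p 1 * _
  rw [h1, h2, zero_add, zero_add]
  by_cases h : p 1 = 0
  · simp [h]
  · rw [div_self h, edgePoint_one]

theorem cone_face_two (g : C(stdSimplex ℝ (Fin 2), ι → ℝ)) :
    (cone g).comp (stdSimplex.mapC (Fin.succAbove 2)) =
      segment 0 (g (stdSimplex.vertex 0)) := by
  ext p i
  have h1 : (stdSimplex.mapC (Fin.succAbove 2) p) 1 = p 1 :=
    mapC_succAbove_apply_succAbove (2 : Fin 3) p 1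
  have h2 : (stdSimplex.mapC (Fin.succAbove 2) p) 2 = 0 :=
    mapC_succAbove_apply_self (2 : Fin 3) p
  change (stdSimplex.mapC (Fin.succAbove 2) p 1 + stdSimplex.mapC (Fin.succAbove 2) p 2) *
    g (edgePoint (stdSimplex.mapC (Fin.succAbove 2) p 2 /
      (stdSimplex.mapC (Fin.succAbove 2) p 1 + stdSimplex.mapC (Fin.succAbove 2) p 2))) i =
    0 + p 1 * _
  rw [h1, h2, zero_div, add_zero, zero_add, edgePoint_zero]

/-- The class of the projection of the segment from `0` to `v`, modulo boundaries. -/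
def segmentClass (v : ι → ℝ) : (chains (ι → UnitAddCircle)).opcycles 1 :=
  opchain (n := 1) (proj.comp (segment 0 v))

/-- The three faces of the cone over `g` are `g` itself and the segments from 0 to its two ends, so
the boundary of the cone is the relation. -/
theorem opchain_proj (g : C(stdSimplex ℝ (Fin 2), ι → ℝ)) :
    opchain (n := 1) (proj.comp g) =
      segmentClass (g (stdSimplex.vertex 1)) - segmentClass (g (stdSimplex.vertex 0)) := by
  have h : opchain (n := 1) (proj.comp g) -
      opchain (n := 1) (proj.comp (segment 0 (g (stdSimplex.vertex 1)))) +
      opchain (n := 1) (proj.comp (segment 0 (g (stdSimplex.vertex 0)))) = 0 := by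
    rw [← cone_face_one, ← cone_face_two]
    nth_rw 1 [← cone_face_zero g]
    exact opchain_relation (proj.comp (cone g))
  rw [segmentClass, segmentClass, ← sub_eq_zero, ← h]
  abel

/-- Translating a segment by a lattice vector does not change its projection. The segment from `n`
to `n + v` therefore has the class of the one from 0 to `v`, and `opchain_proj` evaluates it by its
ends. -/
theorem segmentClass_int_add (n : ι → ℤ) (v : ι → ℝ) :
    segmentClass ((fun i => (n i : ℝ)) + v) =
      segmentClass (fun i => (n i : ℝ)) + segmentClass v := by
  have h : proj.comp (segment (fun i => (n i : ℝ)) v) = proj.comp (segment 0 v) := by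
    ext p i
    exact (UnitAddCircle.coe_eq_coe_iff.2 ⟨n i, by simp [segment]; ring⟩).symm
  have h2 := opchain_proj (segment (fun i => (n i : ℝ)) v)
  rw [h] at h2
  have e0 : segment (fun i => (n i : ℝ)) v (stdSimplex.vertex 0) = fun i => (n i : ℝ) := by
    ext i; simp [segment]
  have e1 : segment (fun i => (n i : ℝ)) v (stdSimplex.vertex 1) = (fun i => (n i : ℝ)) + v := by
    ext i; simp [segment]
  rw [e0, e1] at h2
  rw [segmentClass.eq_1 v, h2]
  abel

/-- The class of the projection of a segment between lattice points, modulo boundaries. -/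
def latticeHom : (ι → ℤ) →+ (chains (ι → UnitAddCircle)).opcycles 1 :=
  AddMonoidHom.mk' (fun n => segmentClass fun i => (n i : ℝ)) fun a b => by
    rw [← segmentClass_int_add]
    congr 1
    ext i
    simp

/-- `latticeHom` as a morphism of modules. -/
def latticeMor : ModuleCat.of ℤ (ι → ℤ) ⟶ (chains (ι → UnitAddCircle)).opcycles 1 :=
  ModuleCat.ofHom
    { toFun := latticeHom
      map_add' := map_add latticeHom
      map_smul' := fun c x => map_intCast_smul latticeHom ℤ ℤ c x }

theorem segmentClass_eq (v : ι → ℝ) :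
    segmentClass v = latticeHom (fun i => ⌊v i⌋) + segmentClass fun i => Int.fract (v i) := by
  refine Eq.trans ?_ (segmentClass_int_add _ _)
  congr 1
  ext i
  simp

/-! ### The advance cocycle -/

/-- A lift of a singular simplex to the universal cover. -/
def simplexLift {n : ℕ} (σ : C(stdSimplex ℝ (Fin (n + 1)), ι → UnitAddCircle)) :
    C(stdSimplex ℝ (Fin (n + 1)), ι → ℝ) :=
  (exists_lift σ).choose

theorem proj_simplexLift {n : ℕ} (σ : C(stdSimplex ℝ (Fin (n + 1)), ι → UnitAddCircle)) :
    proj.comp (simplexLift σ) = σ :=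
  ContinuousMap.ext (exists_lift σ).choose_spec

/-- The number of unit cells through which a singular 1-simplex of the torus advances. -/
def advance (σ : C(stdSimplex ℝ (Fin 2), ι → UnitAddCircle)) : ι → ℤ := fun i =>
  ⌊simplexLift (n := 1) σ (stdSimplex.vertex 1) i⌋ -
    ⌊simplexLift (n := 1) σ (stdSimplex.vertex 0) i⌋

theorem advance_proj (g : C(stdSimplex ℝ (Fin 2), ι → ℝ)) (i : ι) :
    advance (proj.comp g) i =
      ⌊g (stdSimplex.vertex 1) i⌋ - ⌊g (stdSimplex.vertex 0) i⌋ :=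
  floor_sub_floor_eq (fun a => DFunLike.congr_fun (proj_simplexLift (n := 1) (proj.comp g)) a) _ _ i

/-- The advance as a cochain. -/
def advanceHom : (chains (ι → UnitAddCircle)).X 1 ⟶ ModuleCat.of ℤ (ι → ℤ) :=
  desc (n := 1) advance

theorem mapC_vertex {m n : ℕ} (f : Fin m → Fin n) (k : Fin m) :
    stdSimplex.mapC f (stdSimplex.vertex k) = stdSimplex.vertex (f k) :=
  stdSimplex.map_vertex f k

/-- A single lift of the 2-simplex lifts all three edges, and the differences of floors at its
vertices telescope. -/
theorem d_advanceHom :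
    (chains (ι → UnitAddCircle)).d 2 1 ≫ advanceHom = 0 := by
  refine hom_ext fun σ => ?_
  obtain ⟨g, rfl⟩ : ∃ g, σ = proj.comp g := ⟨_, (proj_simplexLift σ).symm⟩
  refine (congrArg advanceHom.hom (d_chain_two _)).trans ?_
  rw [map_add, map_sub, advanceHom, desc_chain (n := 1), desc_chain (n := 1),
    desc_chain (n := 1)]
  funext i
  change advance (proj.comp (g.comp (stdSimplex.mapC (Fin.succAbove 0)))) i -
    advance (proj.comp (g.comp (stdSimplex.mapC (Fin.succAbove 1)))) i +
    advance (proj.comp (g.comp (stdSimplex.mapC (Fin.succAbove 2)))) i = 0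
  simp only [advance_proj, ContinuousMap.comp_apply, mapC_vertex]
  have h00 : (0 : Fin 3).succAbove (0 : Fin 2) = 1 := rfl
  have h01 : (0 : Fin 3).succAbove (1 : Fin 2) = 2 := rfl
  have h10 : (1 : Fin 3).succAbove (0 : Fin 2) = 0 := rfl
  have h11 : (1 : Fin 3).succAbove (1 : Fin 2) = 2 := rfl
  have h20 : (2 : Fin 3).succAbove (0 : Fin 2) = 0 := rfl
  have h21 : (2 : Fin 3).succAbove (1 : Fin 2) = 1 := rfl
  rw [h00, h01, h10, h11, h20, h21]
  ring

/-- The advance on chains modulo boundaries. -/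
def advanceOp : (chains (ι → UnitAddCircle)).opcycles 1 ⟶ ModuleCat.of ℤ (ι → ℤ) :=
  (chains (ι → UnitAddCircle)).descOpcycles advanceHom 2 (by simp) d_advanceHom

theorem advanceOp_opchain (σ : C(stdSimplex ℝ (Fin 2), ι → UnitAddCircle)) :
    advanceOp.hom (opchain (n := 1) σ) = advance σ :=
  (congrArg (fun f => f.hom (chain (n := 1) σ))
    ((chains (ι → UnitAddCircle)).p_descOpcycles advanceHom 2 (by simp) d_advanceHom)).trans
    (desc_chain (n := 1) _ σ)

/-! ### Splitting the chains modulo boundaries -/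

/-- A representative in the unit cell of a point of the torus. -/
def cellLift (x : ι → UnitAddCircle) : ι → ℝ := fun i => Int.fract (x i).out

theorem cellLift_proj (v : ι → ℝ) : cellLift (proj v) = fun i => Int.fract (v i) := by
  funext i
  obtain ⟨n, hn⟩ := UnitAddCircle.coe_eq_coe_iff.1
    (show ((v i : ℝ) : UnitAddCircle) = (Quotient.out (proj v i) : ℝ) from
      (QuotientAddGroup.out_eq' (proj v i)).symm)
  rw [cellLift, hn, Int.fract_add_intCast]

/-- The homomorphism from points to chains modulo boundaries that joins the base point to a point
inside the unit cell. -/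
def cellHom : (chains (ι → UnitAddCircle)).X 0 ⟶ (chains (ι → UnitAddCircle)).opcycles 1 :=
  desc (n := 0) fun x => segmentClass (cellLift (x (stdSimplex.vertex 0)))

/-- Write a simplex as S(b) - S(a) and split each end into floor and fractional part. The floors
contribute through `advance`; the fractional parts depend only on the projected end points, hence on
the boundary. -/
theorem opcycles_decomposition :
    advanceOp ≫ latticeMor +
      (chains (ι → UnitAddCircle)).fromOpcycles 1 0 ≫ cellHom = 𝟙 ((chains (ι → UnitAddCircle)).opcycles 1) := by
  rw [← cancel_epi ((chains (ι → UnitAddCircle)).pOpcycles 1), Category.comp_id]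
  refine hom_ext (n := 1) fun σ => ?_
  obtain ⟨g, rfl⟩ : ∃ g, σ = proj.comp g := ⟨_, (proj_simplexLift (n := 1) σ).symm⟩
  have h1 : cellHom.hom (((chains (ι → UnitAddCircle)).fromOpcycles 1 0).hom
      (opchain (n := 1) (proj.comp g))) =
      segmentClass (fun i => Int.fract (g (stdSimplex.vertex 1) i)) -
        segmentClass (fun i => Int.fract (g (stdSimplex.vertex 0) i)) := by
    have h2 := congrArg (fun f => cellHom.hom (f.hom (chain (n := 1) (proj.comp g))))
      ((chains (ι → UnitAddCircle)).p_fromOpcycles 1 0)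
    refine h2.trans ((congrArg cellHom.hom (d_chain_one _)).trans ?_)
    simp only [map_sub, cellHom, desc_chain, ContinuousMap.comp_apply, mapC_vertex,
      cellLift_proj]
    rfl
  have h3 : latticeHom (advanceOp.hom (opchain (n := 1) (proj.comp g))) =
      latticeHom (fun i => ⌊g (stdSimplex.vertex 1) i⌋) -
        latticeHom (fun i => ⌊g (stdSimplex.vertex 0) i⌋) := by
    rw [advanceOp_opchain, ← map_sub]
    exact congrArg _ (funext fun i => advance_proj g i)
  change latticeHom (advanceOp.hom (opchain (n := 1) (proj.comp g))) +
    cellHom.hom (((chains (ι → UnitAddCircle)).fromOpcycles 1 0).hom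
      (opchain (n := 1) (proj.comp g))) = opchain (n := 1) (proj.comp g)
  rw [h1, h3, opchain_proj, segmentClass_eq (g (stdSimplex.vertex 1)),
    segmentClass_eq (g (stdSimplex.vertex 0))]
  abel

/-- The advance on homology. -/
def homologyToLattice : H1 (ι → UnitAddCircle) →ₗ[ℤ] (ι → ℤ) :=
  ((chains (ι → UnitAddCircle)).homologyι 1 ≫ advanceOp).hom

/-- On homology the boundary term of `opcycles_decomposition` is zero, so a class can be recovered
from its advance. -/
theorem homologyToLattice_injective :
    Function.Injective (homologyToLattice (ι := ι)) := by
  rw [injective_iff_map_eq_zero]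
  intro h hh
  let hM : H1 (ι → UnitAddCircle) →ₗ[ℤ] (chains (ι → UnitAddCircle)).opcycles 1 :=
    ((chains (ι → UnitAddCircle)).homologyι 1).hom
  have hι : Function.Injective ((chains (ι → UnitAddCircle)).homologyι 1).hom :=
    (ModuleCat.mono_iff_injective _).1 inferInstance
  apply hι
  refine Eq.trans ?_ (map_zero hM).symm
  have h1 := congrArg (fun f => f.hom (((chains (ι → UnitAddCircle)).homologyι 1).hom h))
    (opcycles_decomposition (ι := ι))
  have h2 := congrArg (fun f => f.hom h)
    ((chains (ι → UnitAddCircle)).homologyι_comp_fromOpcycles 1 0)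
  refine Eq.trans h1.symm ?_
  change latticeHom (homologyToLattice h) +
    cellHom.hom (((chains (ι → UnitAddCircle)).homologyι 1 ≫
      (chains (ι → UnitAddCircle)).fromOpcycles 1 0).hom h) = 0
  rw [hh, map_zero, zero_add]
  refine (congrArg cellHom.hom h2).trans ?_
  exact map_zero _

theorem homologyToLattice_loopClass (f : C(UnitAddCircle, ι → UnitAddCircle)) {g : ℝ → ι → ℝ}
    (hg : Continuous g) (hf : ∀ s : ℝ, proj (g s) = f s) (i : ι) :
    homologyToLattice (loopClass f) i = ⌊g 1 i⌋ - ⌊g 0 i⌋ := by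
  have h := congrArg advanceOp.hom (homologyι_loopClass f)
  refine (congrFun h i).trans ?_
  rw [advanceOp_opchain]
  let g' : C(stdSimplex ℝ (Fin 2), ι → ℝ) := ⟨fun p => g (p.1 1), hg.comp (continuous_coord 1)⟩
  have := advance_proj g' i
  simp only [g', ContinuousMap.coe_mk, Pi.single_eq_same,
    Pi.single_eq_of_ne (zero_ne_one' (Fin 2)).symm] at this
  rw [← this]
  refine congrArg (fun σ => advance σ i) (ContinuousMap.ext fun p => ?_)
  exact (hf _).symm

end UnitTorus

namespace UnitTorus

theorem homologyToLattice_coordCircle (i : Fin 3) :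
    homologyToLattice (loopClass (coordCircle i)) = Pi.single i 1 := by
  funext j
  rw [homologyToLattice_loopClass (coordCircle i) (g := fun s => Pi.single i s)
    (continuous_single (A := fun _ : Fin 3 => ℝ) i)]
  · rcases eq_or_ne j i with rfl | h <;> simp [*]
  · intro s
    funext j
    rcases eq_or_ne j i with rfl | h <;> simp [coordCircle, *]

/-- The first homology of the 3-torus. -/
def homologyEquiv : H1 Torus3 ≃ₗ[ℤ] (Fin 3 → ℤ) :=
  LinearEquiv.ofBijective homologyToLattice ⟨homologyToLattice_injective, by
    rw [← LinearMap.range_eq_top, eq_top_iff]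
    intro v _
    rw [pi_eq_sum_univ v]
    refine Submodule.sum_mem _ fun i _ => Submodule.smul_mem _ _ ⟨loopClass (coordCircle i), ?_⟩
    rw [homologyToLattice_coordCircle]
    funext j
    simp [Pi.single_apply, eq_comm]⟩

end UnitTorus

/-! ### Counting the crossings of integers -/

open Filter Topology

/-- The continuous function `g` crosses the value `g t` upwards at `t`. -/
def CrossesUp (g : ℝ → ℝ) (t : ℝ) : Prop :=
  (∀ᶠ s in 𝓝[>] t, g t < g s) ∧ ∀ᶠ s in 𝓝[<] t, g s < g t

/-- The continuous function `g` crosses the value `g t` downwards at `t`. -/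
def CrossesDown (g : ℝ → ℝ) (t : ℝ) : Prop :=
  (∀ᶠ s in 𝓝[>] t, g s < g t) ∧ ∀ᶠ s in 𝓝[<] t, g t < g s

section Counting

variable {g : ℝ → ℝ} {sgn : ℝ → ℤ}

open Classical in
/-- The right-continuous version of the integer part of `g`, for a function that crosses the
integers. -/
def rightFloor (g : ℝ → ℝ) (sgn : ℝ → ℤ) (s : ℝ) : ℤ :=
  if (∃ n : ℤ, g s = n) ∧ sgn s = -1 then ⌊g s⌋ - 1 else ⌊g s⌋

theorem rightFloor_eq_of_mem_Ioo {s : ℝ} {n : ℤ} (h : g s ∈ Set.Ioo (n : ℝ) (n + 1)) :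
    rightFloor g sgn s = n := by
  rw [rightFloor, if_neg, Int.floor_eq_iff]
  · exact ⟨h.1.le, h.2⟩
  · rintro ⟨⟨m, hm⟩, -⟩
    rw [hm] at h
    have h1 : n < m := by exact_mod_cast h.1
    have h2 : m < n + 1 := by exact_mod_cast h.2
    omega

/-- At a downward crossing the floor is already one too large for the times just after it; the
correction in `rightFloor` removes exactly this. -/
theorem rightFloor_eventually_right (hg : Continuous g)
    (hs : ∀ t, (∃ n : ℤ, g t = n) →
      (CrossesUp g t ∧ sgn t = 1) ∨ (CrossesDown g t ∧ sgn t = -1)) (t : ℝ) :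
    ∀ᶠ s in 𝓝[>] t, rightFloor g sgn s = rightFloor g sgn t := by
  have lim : Tendsto g (𝓝[>] t) (𝓝 (g t)) := hg.continuousAt.tendsto.mono_left nhdsWithin_le_nhds
  by_cases ht : ∃ n : ℤ, g t = n
  · obtain ⟨n, hn⟩ := id ht
    rcases hs t ht with ⟨h, e⟩ | ⟨h, e⟩
    · have e1 : rightFloor g sgn t = n := by
        rw [rightFloor, if_neg (by rw [e]; simp), hn, Int.floor_intCast]
      filter_upwards [h.1, lim.eventually_lt_const (show g t < n + 1 by rw [hn]; linarith)]
        with s h1 h2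
      rw [e1]
      exact rightFloor_eq_of_mem_Ioo ⟨hn ▸ h1, h2⟩
    · have e1 : rightFloor g sgn t = n - 1 := by
        rw [rightFloor, if_pos ⟨ht, e⟩, hn, Int.floor_intCast]
      filter_upwards [h.1, lim.eventually_const_lt (show (n : ℝ) - 1 < g t by rw [hn]; linarith)]
        with s h1 h2
      rw [e1]
      exact rightFloor_eq_of_mem_Ioo ⟨by push_cast; exact h2, by push_cast; linarith⟩
  · have h0 : (⌊g t⌋ : ℝ) < g t :=
      lt_of_le_of_ne (Int.floor_le _) fun h => ht ⟨_, h.symm⟩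
    filter_upwards [lim.eventually_const_lt h0, lim.eventually_lt_const (Int.lt_floor_add_one _)]
      with s h1 h2
    rw [rightFloor_eq_of_mem_Ioo ⟨h1, h2⟩, rightFloor_eq_of_mem_Ioo ⟨h0, Int.lt_floor_add_one _⟩]

open Classical in
theorem rightFloor_eventually_left (hg : Continuous g)
    (hs : ∀ t, (∃ n : ℤ, g t = n) →
      (CrossesUp g t ∧ sgn t = 1) ∨ (CrossesDown g t ∧ sgn t = -1)) (t : ℝ) :
    ∀ᶠ s in 𝓝[<] t, rightFloor g sgn s =
      rightFloor g sgn t - if ∃ n : ℤ, g t = n then sgn t else 0 := by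
  have lim : Tendsto g (𝓝[<] t) (𝓝 (g t)) := hg.continuousAt.tendsto.mono_left nhdsWithin_le_nhds
  by_cases ht : ∃ n : ℤ, g t = n
  · obtain ⟨n, hn⟩ := id ht
    rw [if_pos ht]
    rcases hs t ht with ⟨h, e⟩ | ⟨h, e⟩
    · have e1 : rightFloor g sgn t = n := by
        rw [rightFloor, if_neg (by rw [e]; simp), hn, Int.floor_intCast]
      filter_upwards [h.2, lim.eventually_const_lt (show (n : ℝ) - 1 < g t by rw [hn]; linarith)]
        with s h1 h2
      rw [e1, e]
      exact rightFloor_eq_of_mem_Ioo ⟨by push_cast; exact h2, by push_cast; linarith⟩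
    · have e1 : rightFloor g sgn t = n - 1 := by
        rw [rightFloor, if_pos ⟨ht, e⟩, hn, Int.floor_intCast]
      filter_upwards [h.2, lim.eventually_lt_const (show g t < n + 1 by rw [hn]; linarith)]
        with s h1 h2
      rw [e1, e, sub_neg_eq_add, sub_add_cancel]
      exact rightFloor_eq_of_mem_Ioo ⟨hn ▸ h1, h2⟩
  · have h0 : (⌊g t⌋ : ℝ) < g t :=
      lt_of_le_of_ne (Int.floor_le _) fun h => ht ⟨_, h.symm⟩
    filter_upwards [lim.eventually_const_lt h0, lim.eventually_lt_const (Int.lt_floor_add_one _)]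
      with s h1 h2
    rw [if_neg ht, rightFloor_eq_of_mem_Ioo ⟨h1, h2⟩,
      rightFloor_eq_of_mem_Ioo ⟨h0, Int.lt_floor_add_one _⟩, sub_zero]

/-- The variation of the integer part is the signed number of crossings. -/
theorem rightFloor_sub_eq_sum (hg : Continuous g)
    (hs : ∀ t, (∃ n : ℤ, g t = n) →
      (CrossesUp g t ∧ sgn t = 1) ∨ (CrossesDown g t ∧ sgn t = -1)) {a b : ℝ} (hab : a ≤ b)
    {Z : Finset ℝ} (hZ : ∀ t, t ∈ Z ↔ t ∈ Set.Ioc a b ∧ ∃ n : ℤ, g t = n) :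
    rightFloor g sgn b - rightFloor g sgn a = ∑ t ∈ Z, sgn t := by
  classical
  -- Both terms are right-continuous step functions with the same jumps on `(a, b]`, so `M` is
  -- locally constant on `[a, b]`.
  let M : ℝ → ℤ := fun s => rightFloor g sgn s - ∑ t ∈ Z with t ≤ s, sgn t
  have key : M a = M b := by
    refine isPreconnected_Icc.induction₂ (fun x y => M x = M y) (fun x hx => ?_)
      (fun x y z _ _ _ h1 h2 => h1.trans h2) (fun x y _ _ h => h.symm)
      (Set.left_mem_Icc.2 hab) (Set.right_mem_Icc.2 hab)
    have right : ∀ᶠ y in 𝓝[>] x, M x = M y := by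
      have h1 : ∀ᶠ y in 𝓝[>] x, ∀ t ∈ Z, t ≤ x ↔ t ≤ y := by
        rw [Filter.eventually_all_finset]
        intro t _
        rcases le_or_gt t x with h | h
        · filter_upwards [self_mem_nhdsWithin] with y hy
          exact ⟨fun _ => h.trans (le_of_lt hy), fun _ => h⟩
        · filter_upwards [nhdsWithin_le_nhds (Iio_mem_nhds h)] with y hy
          exact ⟨fun h' => absurd h' h.not_ge, fun h' => absurd h' (not_le.2 hy)⟩
      filter_upwards [h1, rightFloor_eventually_right hg hs x] with y h1 h2
      simp only [M, h2, Finset.filter_congr h1]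
    have left : a < x → ∀ᶠ y in 𝓝[<] x, M x = M y := by
      intro hax
      have h1 : ∀ᶠ y in 𝓝[<] x, ∀ t ∈ Z, t ≤ y ↔ t < x := by
        rw [Filter.eventually_all_finset]
        intro t _
        rcases lt_or_ge t x with h | h
        · filter_upwards [nhdsWithin_le_nhds (Ioi_mem_nhds h)] with y hy
          exact ⟨fun _ => h, fun _ => le_of_lt hy⟩
        · filter_upwards [self_mem_nhdsWithin] with y hy
          exact ⟨fun h' => lt_of_le_of_lt h' hy, fun h' => absurd h' h.not_gt⟩
      have h3 : ∑ t ∈ Z with t ≤ x, sgn t =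
          (∑ t ∈ Z with t < x, sgn t) + if ∃ n : ℤ, g x = n then sgn x else 0 := by
        split_ifs with h
        · have hxZ : x ∈ Z := (hZ x).2 ⟨⟨hax, hx.2⟩, h⟩
          rw [show Z.filter (· ≤ x) = insert x (Z.filter (· < x)) by
            ext t; simp only [Finset.mem_filter, Finset.mem_insert, le_iff_lt_or_eq]
            grind,
            Finset.sum_insert (by simp), add_comm]
        · rw [add_zero]
          refine Finset.sum_congr (Finset.filter_congr fun t ht => ?_) fun _ _ => rfl
          refine ⟨fun h' => lt_of_le_of_ne h' ?_, le_of_lt⟩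
          rintro rfl
          exact h ((hZ t).1 ht).2
      filter_upwards [h1, rightFloor_eventually_left hg hs x] with y h1 h2
      simp only [M, h2, h3, Finset.filter_congr h1]
      ring
    -- At the left end only the right-hand side matters: a crossing at `a` is not in `Z`, and its
    -- jump is already included in `rightFloor g sgn a`.
    rcases hx.1.eq_or_lt with rfl | hax
    · have : 𝓝[Set.Icc a b] a ≤ 𝓝[≥] a := nhdsWithin_mono _ fun y hy => hy.1
      refine this ?_
      rw [← Set.Ioi_insert, nhdsWithin_insert]
      exact eventually_sup.2 ⟨by simp, right⟩
    · refine nhdsWithin_le_nhds ?_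
      rw [← nhdsLT_sup_nhdsGE, ← Set.Ioi_insert, nhdsWithin_insert]
      exact eventually_sup.2 ⟨left hax, eventually_sup.2 ⟨by simp, right⟩⟩
  have ea : ∑ t ∈ Z with t ≤ a, sgn t = 0 := by
    rw [Finset.filter_false_of_mem fun t ht => not_le.2 ((hZ t).1 ht).1.1, Finset.sum_empty]
  have eb : ∑ t ∈ Z with t ≤ b, sgn t = ∑ t ∈ Z, sgn t := by
    rw [Finset.filter_true_of_mem fun t ht => ((hZ t).1 ht).1.2]
  simp only [M, ea, eb] at key
  linarith

end Counting

/-! ### The strands of a knot at the faces of the cube -/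

open Filter Topology UnitTorus

namespace Cube3

/-- The point of the cube over a point of `ℝ³`, with `i`-th coordinate replaced by `c`. -/
def facePoint (v : Fin 3 → ℝ) (i : Fin 3) (c : unitInterval) : Cube3 := fun j =>
  if j = i then c else ⟨Int.fract (v j), Int.fract_nonneg _, (Int.fract_lt_one _).le⟩

@[simp]
theorem facePoint_self (v : Fin 3 → ℝ) (i : Fin 3) (c : unitInterval) :
    facePoint v i c i = c := if_pos rfl

theorem facePoint_of_ne (v : Fin 3 → ℝ) {i j : Fin 3} (c : unitInterval) (h : j ≠ i) :
    (facePoint v i c j : ℝ) = Int.fract (v j) := by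
  rw [facePoint, if_neg h]

theorem coe_fract (x : ℝ) : ((Int.fract x : ℝ) : UnitAddCircle) = x :=
  UnitAddCircle.coe_eq_coe_iff.2 ⟨⌊x⌋, (Int.fract_add_floor x).symm⟩

theorem coe_eq_zero_of_eq_zero_or_one {c : unitInterval} (hc : c = 0 ∨ c = 1) :
    ((c : ℝ) : UnitAddCircle) = 0 := by
  rcases hc with rfl | rfl <;> simp

theorem coe_int (n : ℤ) : ((n : ℝ) : UnitAddCircle) = 0 := by
  rw [← AddCircle.coe_zero, UnitAddCircle.coe_eq_coe_iff]
  exact ⟨-n, by simp⟩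

theorem cubeQuot_facePoint {v : Fin 3 → ℝ} {i : Fin 3} {c : unitInterval} (hc : c = 0 ∨ c = 1)
    (hv : ∃ n : ℤ, v i = n) : cubeQuot (facePoint v i c) = proj v := by
  funext j
  change ((facePoint v i c j : ℝ) : UnitAddCircle) = v j
  rcases eq_or_ne j i with rfl | h
  · obtain ⟨n, hn⟩ := hv
    rw [facePoint_self, coe_eq_zero_of_eq_zero_or_one hc, hn, coe_int]
  · rw [facePoint_of_ne v c h, coe_fract]

theorem mem_boundary_of_apply {P : Cube3} {i : Fin 3} (h : P i = 0 ∨ P i = 1) :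
    P ∈ Cube.boundary (Fin 3) := ⟨i, h⟩

theorem mem_Ioo_of_notMem_boundary {P : Cube3} (h : P ∉ Cube.boundary (Fin 3)) (i : Fin 3) :
    (P i : ℝ) ∈ Set.Ioo (0 : ℝ) 1 := by
  refine ⟨lt_of_le_of_ne (P i).2.1 fun h0 => h ⟨i, Or.inl (Subtype.ext h0.symm)⟩,
    lt_of_le_of_ne (P i).2.2 fun h1 => h ⟨i, Or.inr (Subtype.ext h1)⟩⟩

end Cube3

open Cube3

namespace OrientedKnot

variable {K : OrientedKnot}

/-- A strand of the knot runs from `P` into the interior of the cube, where the knot is traversed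
with velocity `e`. -/
def HasStrand (K : OrientedKnot) (P : Cube3) (e : ℝ) : Prop :=
  ∃ (t : UnitAddCircle) (ε : ℝ) (a : ℝ → Cube3), 0 < ε ∧ ContinuousOn a (Set.Icc 0 ε) ∧ a 0 = P ∧
    (∀ s ∈ Set.Icc 0 ε, cubeQuot (a s) = K.toMap (t + ((e * s : ℝ) : UnitAddCircle))) ∧
    ∀ s ∈ Set.Ioc 0 ε, a s ∉ Cube.boundary (Fin 3)

theorem startsAt_iff (P : Cube3) : K.StartsAt P ↔ K.HasStrand P 1 := by
  simp only [StartsAt, HasStrand, one_mul]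

theorem endsAt_iff (P : Cube3) : K.EndsAt P ↔ K.HasStrand P (-1) := by
  simp only [EndsAt, HasStrand, neg_one_mul, AddCircle.coe_neg, ← sub_eq_add_neg]

theorem sign_eq_one {P : Cube3} (h : K.HasStrand P 1) : K.sign P = 1 :=
  if_pos ((startsAt_iff P).2 h)

theorem sign_eq_neg_one {P : Cube3} (h : ¬ K.HasStrand P 1) (h' : K.HasStrand P (-1)) :
    K.sign P = -1 := by
  rw [sign, if_neg (mt (startsAt_iff P).1 h), if_pos ((endsAt_iff P).2 h')]

theorem InGeneralPosition.apply_mem_Ioo (hK : K.InGeneralPosition) {P : Cube3}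
    (hP : P ∈ K.inCube) {i : Fin 3} (hi : P i = 0 ∨ P i = 1) {j : Fin 3} (hj : j ≠ i) :
    (P j : ℝ) ∈ Set.Ioo (0 : ℝ) 1 := by
  have h : ∀ h : P j = 0 ∨ P j = 1, False := fun h =>
    Set.disjoint_left.1 hK.avoids_edges hP ⟨j, i, hj, h, hi⟩
  exact ⟨lt_of_le_of_ne (P j).2.1 fun h0 => h (Or.inl (Subtype.ext h0.symm)),
    lt_of_le_of_ne (P j).2.2 fun h1 => h (Or.inr (Subtype.ext h1))⟩

/-! ### Crossings of the lifted knot with integer planes -/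

section Lift

variable {g : ℝ → Fin 3 → ℝ}

theorem facePoint_mem_inCube (hgK : ∀ s : ℝ, proj (g s) = K.toMap s) {t : ℝ} {i : Fin 3}
    {c : unitInterval} (hc : c = 0 ∨ c = 1) (ht : ∃ n : ℤ, g t i = n) :
    facePoint (g t) i c ∈ K.inCube :=
  ⟨t, by rw [cubeQuot_facePoint hc ht, hgK]⟩

/-- Whether a strand starts from a point of a face can be seen on the lift of the knot. -/
theorem hasStrand_facePoint_iff (hK : K.InGeneralPosition) (hg : Continuous g)
    (hgK : ∀ s : ℝ, proj (g s) = K.toMap s) {t : ℝ} {i : Fin 3}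
    {c : unitInterval} (hc : c = 0 ∨ c = 1) (ht : ∃ n : ℤ, g t i = n) (e : ℝ) :
    K.HasStrand (facePoint (g t) i c) e ↔
      ∀ᶠ s in 𝓝[>] (0 : ℝ), (c : ℝ) + (g (t + e * s) i - g t i) ∈ Set.Ioo (0 : ℝ) 1 := by
  have hquot := cubeQuot_facePoint hc ht
  have hcont : ∀ j, Continuous fun s => (facePoint (g t) i c j : ℝ) + (g (t + e * s) j - g t j) :=
    fun j => by fun_prop
  have hcoe : ∀ (j : Fin 3) (s : ℝ), (((facePoint (g t) i c j : ℝ) + (g (t + e * s) j - g t j) : ℝ) :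
      UnitAddCircle) = (g (t + e * s) j : ℝ) := fun j s => by
    have h : ((facePoint (g t) i c j : ℝ) : UnitAddCircle) = (g t j : ℝ) := congrFun hquot j
    rw [AddCircle.coe_add, h, ← AddCircle.coe_add]
    congr 1
    ring
  have hK' : ∀ s : ℝ, K.toMap ((t : UnitAddCircle) + ((e * s : ℝ) : UnitAddCircle)) =
      proj (g (t + e * s)) := fun s => by rw [hgK, AddCircle.coe_add]
  constructor
  · rintro ⟨t', ε, a, hε, ha, ha0, hcube, hint⟩
    have ht' : t' = t := by
      apply K.isEmbedding.injective
      have := hcube 0 ⟨le_rfl, hε.le⟩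
      rw [ha0, hquot, hgK] at this
      simpa using this.symm
    subst ht'
    have hlim : Tendsto a (𝓝[>] 0) (𝓝 (facePoint (g t) i c)) := by
      rw [← ha0]
      exact (ha 0 ⟨le_rfl, hε.le⟩).mono_left (nhdsWithin_le_of_mem (Icc_mem_nhdsGT hε))
    have hlim1 : Tendsto (fun s => ((a s i : unitInterval) : ℝ)) (𝓝[>] 0) (𝓝 (c : ℝ)) := by
      have h := ((continuous_subtype_val.comp (continuous_apply i)).tendsto
        (facePoint (g t) i c)).comp hlim
      simpa [Function.comp_def] using h
    have hlim2 : Tendsto (fun s => (c : ℝ) + (g (t + e * s) i - g t i)) (𝓝[>] 0) (𝓝 (c : ℝ)) := by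
      have h := (hcont i).tendsto 0
      simp only [facePoint_self, mul_zero, add_zero, sub_self] at h
      exact h.mono_left nhdsWithin_le_nhds
    -- The strand and the shifted lift have the same image in the circle, so they differ by
    -- integers; the difference tends to 0 and hence vanishes near the start.
    have hdiff := hlim1.sub hlim2
    rw [sub_self] at hdiff
    filter_upwards [Ioc_mem_nhdsGT hε, hdiff.eventually_lt_const one_pos,
      hdiff.eventually_const_lt (neg_one_lt_zero)] with s hs h1 h2
    have hcs : ((a s i : ℝ) : UnitAddCircle) = (g (t + e * s) i : ℝ) :=
      congrFun ((hcube s ⟨hs.1.le, hs.2⟩).trans (hK' s)) i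
    have hc' := hcoe i s
    rw [facePoint_self] at hc'
    obtain ⟨n, hn⟩ := UnitAddCircle.coe_eq_coe_iff.1 (hc'.trans hcs.symm)
    rw [hn, add_sub_cancel_left] at h1 h2
    have h1' : n < 1 := by exact_mod_cast h1
    have h2' : -1 < n := by exact_mod_cast h2
    obtain rfl : n = 0 := by omega
    rw [Int.cast_zero, add_zero] at hn
    rw [← hn]
    exact mem_Ioo_of_notMem_boundary (hint s hs) i
  · intro h
    -- In the other two coordinates the face point is interior because the knot avoids the edges, so
    -- these coordinates stay in the open interval for a short time.
    have hall : ∀ᶠ s in 𝓝[>] (0 : ℝ), ∀ j,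
        (facePoint (g t) i c j : ℝ) + (g (t + e * s) j - g t j) ∈ Set.Ioo (0 : ℝ) 1 := by
      rw [eventually_all]
      intro j
      rcases eq_or_ne j i with rfl | hj
      · simpa using h
      · have hP := hK.apply_mem_Ioo (facePoint_mem_inCube hgK hc ht)
          (i := i) (by simpa using hc) hj
        refine nhdsWithin_le_nhds ((hcont j).tendsto 0 ?_)
        simp only [mul_zero, add_zero, sub_self]
        exact Ioo_mem_nhds hP.1 hP.2
    obtain ⟨ε, hε, hsub⟩ := mem_nhdsGT_iff_exists_Ioc_subset.1 hall
    refine ⟨t, ε, fun s j => Set.projIcc 0 1 zero_le_one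
      ((facePoint (g t) i c j : ℝ) + (g (t + e * s) j - g t j)), hε, ?_, ?_, ?_, ?_⟩
    · exact (continuous_pi fun j => continuous_projIcc.comp (hcont j)).continuousOn
    · funext j
      simp only [mul_zero, add_zero, sub_self]
      exact Set.projIcc_val zero_le_one _
    · intro s hs
      rw [hK']
      funext j
      have hmem : (facePoint (g t) i c j : ℝ) + (g (t + e * s) j - g t j) ∈ Set.Icc (0 : ℝ) 1 := by
        rcases hs.1.eq_or_lt with rfl | h0
        · simp
        · exact Set.Ioo_subset_Icc_self (hsub ⟨h0, hs.2⟩ j)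
      change ((Set.projIcc 0 1 zero_le_one _ : unitInterval) : ℝ) = (_ : UnitAddCircle)
      rw [Set.projIcc_of_mem zero_le_one hmem]
      exact hcoe j s
    · rintro s hs ⟨j, hj⟩
      have hmem := hsub hs j
      simp only [Set.projIcc_of_mem zero_le_one (Set.Ioo_subset_Icc_self hmem)] at hj
      rcases hj with hj | hj
      · exact hmem.1.ne' (congrArg Subtype.val hj)
      · exact hmem.2.ne (congrArg Subtype.val hj)

/-- Different times in `S` give different points of the knot, hence different face points, and there
are only finitely many of these. -/
theorem finite_crossings (hK : K.InGeneralPosition)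
    (hgK : ∀ s : ℝ, proj (g s) = K.toMap s) (i : Fin 3) {S : Set ℝ}
    (hS : Set.InjOn (fun s : ℝ => (s : UnitAddCircle)) S) :
    {s | s ∈ S ∧ ∃ n : ℤ, g s i = n}.Finite := by
  refine Set.Finite.of_injOn (f := fun s => facePoint (g s) i 0) (fun s hs => ?_) ?_
    hK.finite_boundary
  · exact ⟨facePoint_mem_inCube hgK (Or.inl rfl) hs.2,
      mem_boundary_of_apply (i := i) (Or.inl (facePoint_self _ _ _))⟩
  · intro s hs s' hs' h
    apply hS hs.1 hs'.1
    apply K.isEmbedding.injective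
    rw [← hgK, ← hgK, ← cubeQuot_facePoint (Or.inl rfl) hs.2]
    exact (congrArg cubeQuot h).trans (cubeQuot_facePoint (Or.inl rfl) hs'.2)

theorem injOn_coe_Ioc (a : ℝ) :
    Set.InjOn (fun s : ℝ => (s : UnitAddCircle)) (Set.Ioc a (a + 1)) := by
  intro s hs s' hs' h
  obtain ⟨n, hn⟩ := UnitAddCircle.coe_eq_coe_iff.1 h
  have h1 : (n : ℝ) < 1 := by linarith [hs.1, hs.2, hs'.1, hs'.2]
  have h2 : (-1 : ℝ) < n := by linarith [hs.1, hs.2, hs'.1, hs'.2]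
  have h1' : n < 1 := by exact_mod_cast h1
  have h2' : -1 < n := by exact_mod_cast h2
  obtain rfl : n = 0 := by omega
  simpa using hn.symm

/-- In either direction, a strand starts from one of the two points of the cube over a crossing. -/
theorem hasStrand_or (hK : K.InGeneralPosition) (hg : Continuous g)
    (hgK : ∀ s : ℝ, proj (g s) = K.toMap s) {t : ℝ} {i : Fin 3} (ht : ∃ n : ℤ, g t i = n)
    {e : ℝ} (he : e = 1 ∨ e = -1) :
    K.HasStrand (facePoint (g t) i 0) e ∨ K.HasStrand (facePoint (g t) i 1) e := by
  rw [hasStrand_facePoint_iff hK hg hgK (Or.inl rfl) ht,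
    hasStrand_facePoint_iff hK hg hgK (Or.inr rfl) ht]
  have hcont : Continuous fun s => g (t + e * s) i - g t i := by fun_prop
  -- A return to the integer value `g t i` would be another crossing, and a window of length 1
  -- contains only finitely many.
  have hne : ∀ᶠ s in 𝓝[>] (0 : ℝ), g (t + e * s) i - g t i ≠ 0 := by
    have hinj : Set.InjOn (fun s : ℝ => (s : UnitAddCircle))
        ((fun s => t + e * s) '' Set.Ioo (0 : ℝ) 1) := by
      rcases he with rfl | rfl
      · refine (injOn_coe_Ioc t).mono ?_
        rintro _ ⟨s, hs, rfl⟩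
        exact ⟨by linarith [hs.1], by linarith [hs.2]⟩
      · refine (injOn_coe_Ioc (t - 1)).mono ?_
        rintro _ ⟨s, hs, rfl⟩
        exact ⟨by linarith [hs.2], by linarith [hs.1]⟩
    have hfin := finite_crossings hK hgK i hinj
    have he0 : e ≠ 0 := by rcases he with rfl | rfl <;> norm_num
    have hfin' : {s | s ∈ Set.Ioo (0 : ℝ) 1 ∧ ∃ n : ℤ, g (t + e * s) i = n}.Finite := by
      refine Set.Finite.of_injOn (f := fun s => t + e * s) (fun s hs => ?_) ?_ hfin
      · exact ⟨⟨s, hs.1, rfl⟩, hs.2⟩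
      · intro s _ s' _ h
        exact mul_left_cancel₀ he0 (add_left_cancel h)
    have hopen := hfin'.isClosed.isOpen_compl.mem_nhds
      (show (0 : ℝ) ∈ {s | s ∈ Set.Ioo (0 : ℝ) 1 ∧ ∃ n : ℤ, g (t + e * s) i = n}ᶜ from
        fun h => lt_irrefl _ h.1.1)
    filter_upwards [nhdsWithin_le_nhds hopen, Ioo_mem_nhdsGT one_pos] with s h1 h2 h3
    exact h1 ⟨h2, by rw [sub_eq_zero.1 h3]; exact ht⟩
  have hlim : Tendsto (fun s => g (t + e * s) i - g t i) (𝓝[>] 0) (𝓝 0) := by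
    have h := hcont.tendsto 0
    simp only [mul_zero, add_zero, sub_self] at h
    exact h.mono_left nhdsWithin_le_nhds
  obtain ⟨ε, hε, hsub⟩ := mem_nhdsGT_iff_exists_Ioc_subset.1 hne
  -- By the intermediate value theorem the nonvanishing increment keeps its sign: positive means
  -- leaving from the face at 0, negative from the face at 1.
  have hsign : (∀ s ∈ Set.Ioc 0 ε, 0 < g (t + e * s) i - g t i) ∨
      ∀ s ∈ Set.Ioc 0 ε, g (t + e * s) i - g t i < 0 := by
    by_contra! hcon
    obtain ⟨⟨s, hs, h1⟩, s', hs', h2⟩ := hcon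
    obtain ⟨u, hu, hu0⟩ := isPreconnected_Ioc.intermediate_value hs hs' hcont.continuousOn
      ⟨h1, h2⟩
    exact hsub hu hu0
  rcases hsign with h | h
  · left
    filter_upwards [Ioc_mem_nhdsGT hε, hlim.eventually_lt_const one_pos] with s hs h1
    have := h s hs
    simp only [Set.Icc.coe_zero, zero_add]
    exact ⟨this, h1⟩
  · right
    filter_upwards [Ioc_mem_nhdsGT hε, hlim.eventually_const_lt neg_one_lt_zero] with s hs h1
    have := h s hs
    simp only [Set.Icc.coe_one]
    exact ⟨by linarith, by linarith⟩

/-- The same increment of `g` would have to be positive at one face and negative at the other. -/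
theorem not_hasStrand_and (hK : K.InGeneralPosition) (hg : Continuous g)
    (hgK : ∀ s : ℝ, proj (g s) = K.toMap s) {t : ℝ} {i : Fin 3} (ht : ∃ n : ℤ, g t i = n) (e : ℝ) :
    ¬ (K.HasStrand (facePoint (g t) i 0) e ∧ K.HasStrand (facePoint (g t) i 1) e) := by
  rw [hasStrand_facePoint_iff hK hg hgK (Or.inl rfl) ht,
    hasStrand_facePoint_iff hK hg hgK (Or.inr rfl) ht]
  rintro ⟨h0, h1⟩
  obtain ⟨s, hs0, hs1⟩ := (h0.and h1).exists
  simp only [Set.Icc.coe_zero, Set.Icc.coe_one] at hs0 hs1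
  linarith [hs0.1, hs1.2]

theorem tendsto_sub_nhdsGT (t : ℝ) : Tendsto (fun s => s - t) (𝓝[>] t) (𝓝[>] 0) := by
  refine tendsto_nhdsWithin_iff.2 ⟨?_, ?_⟩
  · have : Continuous fun s : ℝ => s - t := by fun_prop
    simpa using (this.tendsto t).mono_left nhdsWithin_le_nhds
  · filter_upwards [self_mem_nhdsWithin] with s hs
    exact sub_pos.2 (Set.mem_Ioi.1 hs)

theorem tendsto_sub_nhdsLT (t : ℝ) : Tendsto (fun s => t - s) (𝓝[<] t) (𝓝[>] 0) := by
  refine tendsto_nhdsWithin_iff.2 ⟨?_, ?_⟩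
  · have : Continuous fun s : ℝ => t - s := by fun_prop
    simpa using (this.tendsto t).mono_left nhdsWithin_le_nhds
  · filter_upwards [self_mem_nhdsWithin] with s hs
    exact sub_pos.2 (Set.mem_Iio.1 hs)

/-- The knot crosses a face upwards or downwards, as told by the signs of the two points of the
cube over the crossing. -/
theorem crosses (hK : K.InGeneralPosition) (hg : Continuous g)
    (hgK : ∀ s : ℝ, proj (g s) = K.toMap s) {t : ℝ} {i : Fin 3} (ht : ∃ n : ℤ, g t i = n) :
    ((CrossesUp (fun s => g s i) t ∧ K.sign (facePoint (g t) i 0) = 1) ∨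
      (CrossesDown (fun s => g s i) t ∧ K.sign (facePoint (g t) i 0) = -1)) ∧
      -K.sign (facePoint (g t) i 1) = K.sign (facePoint (g t) i 0) := by
  have touch : ∀ c : unitInterval, c = 0 ∨ c = 1 →
      ¬ (K.HasStrand (facePoint (g t) i c) 1 ∧ K.HasStrand (facePoint (g t) i c) (-1)) := by
    intro c hc
    rw [← startsAt_iff, ← endsAt_iff]
    exact hK.not_touching _ ⟨facePoint_mem_inCube hgK hc ht,
      mem_boundary_of_apply (i := i) (by simpa using hc)⟩
  have t0 := touch 0 (Or.inl rfl)
  have t1 := touch 1 (Or.inr rfl)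
  have p := hasStrand_or hK hg hgK ht (Or.inl rfl : (1 : ℝ) = 1 ∨ (1 : ℝ) = -1)
  have m := hasStrand_or hK hg hgK ht (Or.inr rfl : (-1 : ℝ) = 1 ∨ (-1 : ℝ) = -1)
  have np := not_hasStrand_and hK hg hgK ht 1
  have i0 := hasStrand_facePoint_iff hK hg hgK (c := 0) (Or.inl rfl) ht
  have i1 := hasStrand_facePoint_iff hK hg hgK (c := 1) (Or.inr rfl) ht
  -- The face from which the forward strand leaves decides everything: `touch` forces the backward
  -- strand onto the opposite face.
  by_cases h : K.HasStrand (facePoint (g t) i 0) 1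
  · have h1 : ¬ K.HasStrand (facePoint (g t) i 1) 1 := fun h' => np ⟨h, h'⟩
    have h2 : K.HasStrand (facePoint (g t) i 1) (-1) := m.resolve_left fun h' => t0 ⟨h, h'⟩
    refine ⟨Or.inl ⟨⟨?_, ?_⟩, sign_eq_one h⟩, by
      rw [sign_eq_one h, sign_eq_neg_one h1 h2, neg_neg]⟩
    · filter_upwards [(tendsto_sub_nhdsGT t).eventually ((i0 1).1 h)] with s hs
      have := hs.1
      simp only [Set.Icc.coe_zero, one_mul, add_sub_cancel] at this
      linarith
    · filter_upwards [(tendsto_sub_nhdsLT t).eventually ((i1 (-1)).1 h2)] with s hs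
      have := hs.2
      simp only [Set.Icc.coe_one, neg_one_mul, neg_sub, add_sub_cancel] at this
      linarith
  · have h1 : K.HasStrand (facePoint (g t) i 1) 1 := p.resolve_left h
    have h2 : K.HasStrand (facePoint (g t) i 0) (-1) := m.resolve_right fun h' => t1 ⟨h1, h'⟩
    refine ⟨Or.inr ⟨⟨?_, ?_⟩, sign_eq_neg_one h h2⟩, by
      rw [sign_eq_one h1, sign_eq_neg_one h h2]⟩
    · filter_upwards [(tendsto_sub_nhdsGT t).eventually ((i1 1).1 h1)] with s hs
      have := hs.2
      simp only [Set.Icc.coe_one, one_mul, add_sub_cancel] at this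
      linarith
    · filter_upwards [(tendsto_sub_nhdsLT t).eventually ((i0 (-1)).1 h2)] with s hs
      have := hs.1
      simp only [Set.Icc.coe_zero, neg_one_mul, neg_sub, add_sub_cancel] at this
      linarith

/-- A point of the knot on the face has its other coordinates strictly inside `(0, 1)`, so they are
the fractional parts of the lift. The half-open interval counts the base point only once. -/
theorem bijOn_facePoint (hK : K.InGeneralPosition)
    (hgK : ∀ s : ℝ, proj (g s) = K.toMap s) (i : Fin 3) {c : unitInterval} (hc : c = 0 ∨ c = 1) :
    Set.BijOn (fun t => facePoint (g t) i c)
      {t | t ∈ Set.Ioc (0 : ℝ) 1 ∧ ∃ n : ℤ, g t i = n} (K.inCube ∩ {P | P i = c}) := by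
  refine ⟨fun t ht => ⟨facePoint_mem_inCube hgK hc ht.2, facePoint_self _ _ _⟩, ?_, ?_⟩
  · intro s hs s' hs' h
    have hinj := injOn_coe_Ioc 0
    rw [zero_add] at hinj
    apply hinj hs.1 hs'.1
    apply K.isEmbedding.injective
    rw [← hgK, ← hgK, ← cubeQuot_facePoint hc hs.2]
    exact (congrArg cubeQuot h).trans (cubeQuot_facePoint hc hs'.2)
  · rintro P ⟨hP, hPc⟩
    obtain ⟨x, hx⟩ := id hP
    obtain ⟨t, ht, rfl⟩ : ∃ t ∈ Set.Ioc (0 : ℝ) 1, (t : UnitAddCircle) = x := by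
      have := AddCircle.coe_image_Ioc_eq (1 : ℝ) 0
      rw [zero_add] at this
      have hx' : x ∈ ((↑) : ℝ → UnitAddCircle) '' Set.Ioc 0 1 := by rw [this]; trivial
      exact hx'
    rw [← hgK] at hx
    have hcoe : ∀ j, ((P j : ℝ) : UnitAddCircle) = (g t j : ℝ) := fun j => (congrFun hx j).symm
    have hPi : P i = 0 ∨ P i = 1 := by rw [show P i = c from hPc]; exact hc
    refine ⟨t, ⟨ht, ?_⟩, ?_⟩
    · have h := hcoe i
      rw [coe_eq_zero_of_eq_zero_or_one hPi, ← AddCircle.coe_zero,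
        UnitAddCircle.coe_eq_coe_iff] at h
      obtain ⟨n, hn⟩ := h
      exact ⟨n, by rw [hn, zero_add]⟩
    · funext j
      rcases eq_or_ne j i with rfl | hj
      · exact (facePoint_self _ _ _).trans (Eq.symm hPc)
      · apply Subtype.ext
        change (facePoint (g t) i c j : ℝ) = P j
        rw [facePoint_of_ne _ _ hj]
        obtain ⟨n, hn⟩ := UnitAddCircle.coe_eq_coe_iff.1 (hcoe j)
        have h := hK.apply_mem_Ioo hP hPi hj
        rw [hn, Int.fract_add_intCast, Int.fract_eq_self.2 ⟨h.1.le, h.2⟩]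

/-- The signed number of points of the knot on a face is the variation of a coordinate. -/
theorem floor_sub_floor_eq_finsum (hK : K.InGeneralPosition) (hg : Continuous g)
    (hgK : ∀ s : ℝ, proj (g s) = K.toMap s) (i : Fin 3) {c : unitInterval} (hc : c = 0 ∨ c = 1)
    {F : Cube3 → ℤ} (hF : ∀ t, (∃ n : ℤ, g t i = n) →
      F (facePoint (g t) i c) = K.sign (facePoint (g t) i 0)) :
    ⌊g 1 i⌋ - ⌊g 0 i⌋ = ∑ᶠ P ∈ K.inCube ∩ {P | P i = c}, F P := by
  have hinj := injOn_coe_Ioc 0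
  rw [zero_add] at hinj
  have hfin := finite_crossings hK hgK i hinj
  have hperiod : proj (g 0) = proj (g 1) := by
    rw [hgK, hgK]
    congr 1
    exact UnitAddCircle.coe_eq_coe_iff.2 ⟨1, by simp⟩
  have hface : facePoint (g 1) i 0 = facePoint (g 0) i 0 := by
    funext j
    apply Subtype.ext
    obtain ⟨n, hn⟩ := UnitAddCircle.coe_eq_coe_iff.1 (congrFun hperiod j)
    rcases eq_or_ne j i with rfl | hj
    · simp
    · rw [facePoint_of_ne _ _ hj, facePoint_of_ne _ _ hj, hn, Int.fract_add_intCast]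
  have hsum := rightFloor_sub_eq_sum (g := fun s => g s i)
    (sgn := fun s => K.sign (facePoint (g s) i 0)) (by fun_prop)
    (fun t ht => (crosses hK hg hgK ht).1) zero_le_one (Z := hfin.toFinset) (by simp)
  obtain ⟨n, hn⟩ := UnitAddCircle.coe_eq_coe_iff.1 (congrFun hperiod i)
  have hint : (∃ m : ℤ, g 1 i = m) ↔ ∃ m : ℤ, g 0 i = m := by
    rw [hn]
    constructor
    · rintro ⟨m, hm⟩
      exact ⟨m - n, by push_cast; linarith⟩
    · rintro ⟨m, hm⟩
      exact ⟨m + n, by push_cast; linarith⟩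
  calc ⌊g 1 i⌋ - ⌊g 0 i⌋ = _ := by
        -- The base point of the knot may lie on a face. Times 0 and 1 then give the same face point
        -- and sign, so the corrections in `rightFloor` cancel.
        have hint' : ((∃ m : ℤ, g 1 i = m) ∧ K.sign (facePoint (g 1) i 0) = -1) ↔
            (∃ m : ℤ, g 0 i = m) ∧ K.sign (facePoint (g 0) i 0) = -1 := by rw [hface, hint]
        simp only [rightFloor]
        by_cases h : (∃ m : ℤ, g 0 i = m) ∧ K.sign (facePoint (g 0) i 0) = -1
        · rw [if_pos h, if_pos (hint'.2 h)]
          ring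
        · rw [if_neg h, if_neg (mt hint'.1 h)]
    _ = _ := hsum
    _ = ∑ᶠ t ∈ {t | t ∈ Set.Ioc (0 : ℝ) 1 ∧ ∃ n : ℤ, g t i = n},
          K.sign (facePoint (g t) i 0) := by
        rw [← finsum_mem_coe_finset, hfin.coe_toFinset]
    _ = _ := finsum_mem_eq_of_bijOn _ (bijOn_facePoint hK hgK i hc) fun t ht => (hF t ht.2).symm

end Lift

theorem homologyToLattice_homologyClass (hK : K.InGeneralPosition) :
    homologyToLattice K.homologyClass = ![K.delta, K.sigma, K.xi] := by
  obtain ⟨g, hg⟩ := exists_lift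
    (K.toMap.comp (⟨fun s => (s : UnitAddCircle), AddCircle.continuous_mk' 1⟩ : C(ℝ, UnitAddCircle)))
  have hgK : ∀ s : ℝ, proj (g s) = K.toMap s := hg
  funext i
  rw [homologyClass, homologyToLattice_loopClass K.toMap g.continuous hgK]
  fin_cases i
  · exact floor_sub_floor_eq_finsum hK g.continuous hgK 0 (Or.inl rfl) fun _ _ => rfl
  · exact floor_sub_floor_eq_finsum hK g.continuous hgK 1 (Or.inl rfl) fun _ _ => rfl
  · exact floor_sub_floor_eq_finsum hK g.continuous hgK 2 (Or.inr rfl) fun _ ht =>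
      (crosses hK g.continuous hgK ht).2

end OrientedKnot

end

theorem mainTheorem4 :
    ∃ Φ : H1 Torus3 ≃ₗ[ℤ] (Fin 3 → ℤ),
      (∀ i : Fin 3, Φ (loopClass (coordCircle i)) = Pi.single i 1) ∧
      ∀ K : OrientedKnot, K.InGeneralPosition →
        Φ K.homologyClass = ![K.delta, K.sigma, K.xi] :=
  ⟨UnitTorus.homologyEquiv, UnitTorus.homologyToLattice_coordCircle,
    fun _ hK => OrientedKnot.homologyToLattice_homologyClass hK⟩
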